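/- Let $G_r$ and $G_c$ be undirected weighted graphs (symmetric, nonnegative weights) on the vertex sets $\{1,\dots,p\}$ and $\{1,\dots,n\}$, and let $\mathcal L_r\in\mathbb R^{p\times p}$, $\mathcal L_c\in\mathbb R^{n\times n}$ be their graph Laplacians (combinatorial, $D-W$, or normalized, $D^{-1/2}(D-W)D^{-1/2}$, where $W$ is the weight matrix and $D$ the diagonal matrix of degrees). Let $\mathcal L_r=P\Lambda_rP^\top$ and $\mathcal L_c=Q\Lambda_cQ^\top$ with $P,Q$ orthogonal and $\Lambda_r,\Lambda_c$ diagonal with entries sorted in increasing order. For $k_r\le p$ and $k_c\le n$ let $P_{k_r}$ and $Q_{k_c}$ consist of the first $k_r$ columns of $P$ and the first $k_c$ columns of $Q$. Let $\mathcal{LR}(P_{k_r},Q_{k_c})$ be the set of matrices $Y\in\mathbb R^{p\times n}$ whose columns all lie in $\mathrm{span}(P_{k_r})$ and whose rows all lie in $\mathrm{span}(Q_{k_c})$ (spans of the columns). Define the cumulative coherences $$\nu_{k_c}=\max_{1\le i\le n}\sqrt n\,\|Q_{k_c}^\top e_i\|_2,\qquad \nu_{k_r}=\max_{1\le j\le p}\sqrt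 p\,\|P_{k_r}^\top e_j\|_2,$$ where $e_i$ denotes the $i$-th standard basis vector (of $\mathbb R^n$, respectively $\mathbb R^p$). Let $\omega^r_1,\dots,\omega^r_{\rho_r}$ be indices drawn uniformly without replacement from $\{1,\dots,p\}$, and let $\omega^c_1,\dots,\omega^c_{\rho_c}$ be indices drawn uniformly without replacement from $\{1,\dots,n\}$. Let $M_r\in\{0,1\}^{\rho_r\times p}$ have entries $(M_r)_{ij}=1$ if and only if $j=\omega^r_i$, and let $M_c\in\{0,1\}^{n\times\rho_c}$ have entries $(M_c)_{ij}=1$ if and only if $i=\omega^c_j$. Then for any $\delta,\epsilon\in(0,1)$ such that $$\rho_c\ge\frac{27}{\delta^2}\,\nu_{k_c}^2\log\Big(\frac{4k_c}{\epsilon}\Big)\quad\text{and}\quad \rho_r\ge\frac{27}{\delta^2}\,\nu_{k_r}^2\log\Big(\frac{4k_r}{\epsilon}\Big),$$ with probability at least $1-\epsilon$ one has, simultaneously for all $Y\in\mathcal{LR}(P_{k_r},Q_{k_c})$, $$(1-\delta)\|Y\|_F^2\le\frac{np}{\rho_r\rho_c}\|M_rYM_c\|_F^2\le(1+\delta)\|Y\|_F^2,$$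 where $\|\cdot\|_F$ is the Frobenius norm. -/

import Mathlib

open MeasureTheory ProbabilityTheory

attribute [local instance] Matrix.frobeniusNormedAddCommGroup

noncomputable section

/-- A finite undirected weighted graph on the vertex set `V`, given by its symmetric weighted
adjacency matrix with nonnegative entries. -/
structure WeightedGraph (V : Type*) where
  W : Matrix V V ℝ
  symm : ∀ i j, W i j = W j i
  nonneg : ∀ i j, 0 ≤ W i j

namespace WeightedGraph

variable {V : Type*} [Fintype V] [DecidableEq V]

/-- The degree `D i i = ∑ j, W i j` of a vertex. -/
def degree (G : WeightedGraph V) (i : V) : ℝ := ∑ j, G.W i j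

/-- The combinatorial Laplacian `D - W`. -/
def laplacian (G : WeightedGraph V) : Matrix V V ℝ := Matrix.diagonal G.degree - G.W

/-- The normalized Laplacian `D ^ (-1/2) (D - W) D ^ (-1/2)`, with the usual convention that
`D ^ (-1/2)` vanishes at the isolated vertices. -/
def normalizedLaplacian (G : WeightedGraph V) : Matrix V V ℝ :=
  Matrix.diagonal (fun i => (√(G.degree i))⁻¹) * G.laplacian *
    Matrix.diagonal (fun i => (√(G.degree i))⁻¹)

/-- `L` is a Laplacian of `G`, either the combinatorial or the normalized one. -/
def IsLaplacian (G : WeightedGraph V) (L : Matrix V V ℝ) : Prop :=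
  L = G.laplacian ∨ L = G.normalizedLaplacian

end WeightedGraph

/-- `L = Q Λ Qᵀ` with `Q` orthogonal and `Λ = diag(lam 0, ..., lam (n-1))` sorted in increasing
order. The columns of `Q` are the (Fourier) eigenvectors of `L`. -/
structure IsSortedEigendecomposition {n : ℕ} (L Q : Matrix (Fin n) (Fin n) ℝ)
    (lam : Fin n → ℝ) : Prop where
  orthogonal : Q ∈ Matrix.orthogonalGroup (Fin n) ℝ
  sorted : Monotone lam
  eq : L = Q * Matrix.diagonal lam * Q.transpose

/-- The `n × k` matrix `Q_k` made of the first `k` columns of `Q`. -/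
def firstCols {n : ℕ} (Q : Matrix (Fin n) (Fin n) ℝ) (k : ℕ) (hk : k ≤ n) :
    Matrix (Fin n) (Fin k) ℝ :=
  Q.submatrix id (Fin.castLE hk)

/-- The span of the columns of a matrix. -/
def colSpan {n k : ℕ} (A : Matrix (Fin n) (Fin k) ℝ) : Submodule ℝ (Fin n → ℝ) :=
  Submodule.span ℝ (Set.range A.col)

/-- The cumulative coherence `max_i √n ‖Q_kᵀ Δ_i‖₂`, where `Δ_i` is the indicator vector of
the vertex `i` and `‖·‖₂` is the Euclidean norm. (The supremum of finitely many reals is their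
maximum.) -/
def cumulativeCoherence {n k : ℕ} (Qk : Matrix (Fin n) (Fin k) ℝ) : ℝ :=
  ⨆ i : Fin n, √(n : ℝ) * ‖WithLp.toLp 2 (Qk.transpose.mulVec (Pi.single i 1))‖

/-- The set of `p × n` matrices all of whose columns lie in `span(P_k)` and all of whose rows
lie in `span(Q_k)`. -/
def lowRankOnGraphs {p n kr kc : ℕ} (Pk : Matrix (Fin p) (Fin kr) ℝ)
    (Qk : Matrix (Fin n) (Fin kc) ℝ) : Set (Matrix (Fin p) (Fin n) ℝ) :=
  {Y | (∀ j, Y.col j ∈ colSpan Pk) ∧ (∀ i, Y.row i ∈ colSpan Qk)}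

/-- The `ρ × p` row subsampling matrix: entry `(i, j)` is `1` if `j = ω i` and `0` otherwise. -/
def rowSampling {ρ p : ℕ} (ω : Fin ρ → Fin p) : Matrix (Fin ρ) (Fin p) ℝ :=
  Matrix.of fun i j => if j = ω i then 1 else 0

/-- The `n × ρ` column subsampling matrix: entry `(i, j)` is `1` if `i = ω j` and `0`
otherwise. -/
def colSampling {ρ n : ℕ} (ω : Fin ρ → Fin n) : Matrix (Fin n) (Fin ρ) ℝ :=
  Matrix.of fun i j => if i = ω j then 1 else 0

/-- The random tuple `(ω 0, ..., ω (ρ-1))` consists of `ρ` indices drawn uniformly without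
replacement from `n`: its law is the uniform law on the injective tuples. (Such a random tuple
exists on a probability space only if `ρ ≤ n`.) -/
def IsUniformWithoutReplacement {S : Type*} [MeasurableSpace S] (μ : Measure S) {ρ n : ℕ}
    (ω : S → Fin ρ → Fin n) : Prop :=
  HasLaw ω (uniformOn {f : Fin ρ → Fin n | Function.Injective f}) μ

end

/-!
Sampling the rows of a matrix acts on each of its columns and sampling the columns acts on each of
its rows, so it suffices that each of the two samplings almost preserves the energy on the
corresponding subspace; a union bound combines the two. On the column span of `A` with
`Aᵀ * A = 1` and rows `q j`, this asks for bounds on the extreme eigenvalues of the Gram matrix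
`∑ i, q (ω i) (q (ω i))ᵀ` of the sampled rows, which follow from Markov's inequality for the trace
of the exponential of its multiples. Since `S ↦ tr exp S` is convex, exchanging draws as in
Hoeffding's comparison shows that the mean of this trace is at most its mean under sampling with
replacement. There each draw multiplies the mean by at most `exp (θ exp (θ R) / n)`, where `R`
bounds all `‖q j‖²`: Klein's inequality gives
`tr exp (S + θ q qᵀ) - tr exp S ≤ θ qᵀ exp (S + θ q qᵀ) q`, the right-hand side is at most
`θ exp (θ ‖q‖²) qᵀ exp S q`, and averaging over `q = q j` replaces `q qᵀ` by the identity over `n`.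
-/

section TraceExp

open Matrix
open scoped BigOperators

theorem isHermitian_smul_vecMulVec {ι : Type*} (s : ℝ) (x : ι → ℝ) :
    (s • vecMulVec x x).IsHermitian := by
  ext i j
  simp [vecMulVec_apply, mul_comm]

theorem sum_vecMulVec_row {ι κ : Type*} [Fintype κ] (A : Matrix κ ι ℝ) :
    ∑ j, vecMulVec (A j) (A j) = Aᵀ * A := by
  ext i l
  simp [Matrix.sum_apply, vecMulVec_apply, Matrix.mul_apply]

variable {ι κ : Type*} [Fintype ι] [Fintype κ]

theorem trace_mul_vecMulVec (M : Matrix ι ι ℝ) (x : ι → ℝ) :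
    (M * vecMulVec x x).trace = x ⬝ᵥ M *ᵥ x := by
  rw [mul_vecMulVec, trace_vecMulVec, dotProduct_comm]

theorem dotProduct_smul_vecMulVec_mulVec (s : ℝ) (x z : ι → ℝ) :
    z ⬝ᵥ (s • vecMulVec x x) *ᵥ z = s * (x ⬝ᵥ z) ^ 2 := by
  rw [smul_mulVec, vecMulVec_mulVec, op_smul_eq_smul, dotProduct_smul, dotProduct_smul,
    smul_eq_mul, smul_eq_mul, dotProduct_comm z, sq]

theorem dotProduct_mul_vecMulVec_mul (A B : Matrix ι ι ℝ) (x : ι → ℝ) :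
    x ⬝ᵥ (A * vecMulVec x x * B) *ᵥ x = (x ⬝ᵥ A *ᵥ x) * (x ⬝ᵥ B *ᵥ x) := by
  rw [← Matrix.mulVec_mulVec, ← Matrix.mulVec_mulVec, vecMulVec_mulVec, op_smul_eq_smul,
    mulVec_smul, dotProduct_smul, smul_eq_mul, mul_comm]

theorem dotProduct_conj_diagonal (U : Matrix ι κ ℝ) [DecidableEq κ] (a : κ → ℝ) (x : ι → ℝ) :
    x ⬝ᵥ (U * diagonal a * Uᵀ) *ᵥ x = ∑ i, a i * (Uᵀ *ᵥ x) i ^ 2 := by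
  rw [← Matrix.mulVec_mulVec, ← Matrix.mulVec_mulVec, dotProduct_mulVec, ← mulVec_transpose,
    dotProduct]
  exact Finset.sum_congr rfl fun i _ => by rw [mulVec_diagonal]; ring

theorem trace_conj_diagonal_mul (U : Matrix ι κ ℝ) [DecidableEq κ] (a : κ → ℝ)
    (M : Matrix ι ι ℝ) :
    (U * diagonal a * Uᵀ * M).trace = ∑ i, a i * (Uᵀ i ⬝ᵥ M *ᵥ Uᵀ i) := by
  rw [Matrix.mul_assoc, Matrix.mul_assoc, trace_mul_comm, Matrix.mul_assoc, Matrix.mul_assoc, trace]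
  refine Finset.sum_congr rfl fun i _ => ?_
  rw [diag_apply, diagonal_mul]
  rfl

variable [DecidableEq ι]

theorem sum_dotProduct_mulVec_eq_trace {q : κ → ι → ℝ} (hq : ∑ j, vecMulVec (q j) (q j) = 1)
    (M : Matrix ι ι ℝ) : ∑ j, q j ⬝ᵥ M *ᵥ q j = M.trace := by
  simp_rw [← trace_mul_vecMulVec, ← trace_sum, ← Finset.mul_sum, hq, Matrix.mul_one]

/-! ### Diagonalization -/

theorem exists_orthogonal_diagonalization {A : Matrix ι ι ℝ} (hA : A.IsHermitian) :
    ∃ U ∈ orthogonalGroup ι ℝ, ∃ a : ι → ℝ, A = U * diagonal a * Uᵀ :=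
  ⟨hA.eigenvectorUnitary, hA.eigenvectorUnitary.2, hA.eigenvalues, hA.spectral_theorem⟩

theorem inv_eq_transpose_of_mem_orthogonalGroup {U : Matrix ι ι ℝ}
    (hU : U ∈ orthogonalGroup ι ℝ) : U⁻¹ = Uᵀ :=
  inv_eq_right_inv ((mem_orthogonalGroup_iff ι ℝ).1 hU)

theorem exp_conj_diagonal {U : Matrix ι ι ℝ} (hU : U ∈ orthogonalGroup ι ℝ) (a : ι → ℝ) :
    NormedSpace.exp (U * diagonal a * Uᵀ) = U * diagonal (fun i => Real.exp (a i)) * Uᵀ := by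
  have hunit : IsUnit U := IsUnit.of_mul_eq_one _ ((mem_orthogonalGroup_iff ι ℝ).1 hU)
  rw [← inv_eq_transpose_of_mem_orthogonalGroup hU, exp_conj U _ hunit, exp_diagonal,
    Pi.exp_def, Real.exp_eq_exp_ℝ]

theorem pow_conj_diagonal {U : Matrix ι ι ℝ} (hU : U ∈ orthogonalGroup ι ℝ) (a : ι → ℝ) (N : ℕ) :
    (U * diagonal a * Uᵀ) ^ N = U * diagonal (fun i => a i ^ N) * Uᵀ := by
  have h := Units.conj_pow (Unitary.toUnits ⟨U, hU⟩) (diagonal a) N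
  rw [diagonal_pow] at h
  exact h

theorem sum_transpose_mulVec_sq {U : Matrix ι ι ℝ} (hU : U ∈ orthogonalGroup ι ℝ) (x : ι → ℝ) :
    ∑ i, (Uᵀ *ᵥ x) i ^ 2 = x ⬝ᵥ x := by
  simpa [(mem_orthogonalGroup_iff ι ℝ).1 hU] using (dotProduct_conj_diagonal U 1 x).symm

theorem posSemidef_exp {A : Matrix ι ι ℝ} (hA : A.IsHermitian) :
    (NormedSpace.exp A).PosSemidef := by
  obtain ⟨U, hU, a, rfl⟩ := exists_orthogonal_diagonalization hA
  rw [exp_conj_diagonal hU]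
  exact (posSemidef_diagonal_iff.2 fun i => (Real.exp_pos (a i)).le).mul_mul_conjTranspose_same U

theorem exp_add_smul_one (A : Matrix ι ι ℝ) (c : ℝ) :
    NormedSpace.exp (A + c • 1) = Real.exp c • NormedSpace.exp A := by
  rw [exp_add_of_commute _ _ ((Commute.one_right A).smul_right c), smul_one_eq_diagonal,
    exp_diagonal, Pi.exp_def, ← Real.exp_eq_exp_ℝ, ← smul_one_eq_diagonal, Matrix.mul_smul,
    Matrix.mul_one]

/-! ### Convexity of the trace exponential -/

theorem exp_mul_one_add_sub_le_exp (t b : ℝ) : Real.exp t * (1 + (b - t)) ≤ Real.exp b := by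
  calc Real.exp t * (1 + (b - t)) ≤ Real.exp t * Real.exp (b - t) := by
        gcongr
        linarith [Real.add_one_le_exp (b - t)]
    _ = Real.exp b := by rw [← Real.exp_add, add_sub_cancel]

theorem exp_mul_le_dotProduct_exp {B : Matrix ι ι ℝ} (hB : B.IsHermitian) (t : ℝ) (x : ι → ℝ) :
    Real.exp t * (x ⬝ᵥ x + (x ⬝ᵥ B *ᵥ x - t * (x ⬝ᵥ x))) ≤ x ⬝ᵥ NormedSpace.exp B *ᵥ x := by
  obtain ⟨U, hU, b, rfl⟩ := exists_orthogonal_diagonalization hB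
  rw [exp_conj_diagonal hU, dotProduct_conj_diagonal, dotProduct_conj_diagonal,
    ← sum_transpose_mulVec_sq hU, Finset.mul_sum, ← Finset.sum_sub_distrib,
    ← Finset.sum_add_distrib, Finset.mul_sum]
  refine Finset.sum_le_sum fun i _ => ?_
  calc _ = Real.exp t * (1 + (b i - t)) * (Uᵀ *ᵥ x) i ^ 2 := by ring
    _ ≤ _ := by gcongr; exact exp_mul_one_add_sub_le_exp t (b i)

theorem trace_exp_add_trace_exp_mul_sub_le {A B : Matrix ι ι ℝ} (hA : A.IsHermitian)
    (hB : B.IsHermitian) :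
    (NormedSpace.exp A).trace + (NormedSpace.exp A * (B - A)).trace ≤
      (NormedSpace.exp B).trace := by
  obtain ⟨U, hU, a, rfl⟩ := exists_orthogonal_diagonalization hA
  have hUU := (mem_orthogonalGroup_iff' ι ℝ).1 hU
  have hq : ∑ i, vecMulVec (Uᵀ i) (Uᵀ i) = 1 := by
    rw [sum_vecMulVec_row, transpose_transpose, (mem_orthogonalGroup_iff ι ℝ).1 hU]
  have htr : ∀ d : ι → ℝ, (U * diagonal d * Uᵀ).trace = ∑ i, d i * (Uᵀ i ⬝ᵥ Uᵀ i) := fun d => by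
    simpa using trace_conj_diagonal_mul U d 1
  have hAA : U * diagonal (fun i => Real.exp (a i)) * Uᵀ * (U * diagonal a * Uᵀ) =
      U * diagonal (fun i => Real.exp (a i) * a i) * Uᵀ := by
    rw [← diagonal_mul_diagonal]
    simp only [Matrix.mul_assoc]
    rw [← Matrix.mul_assoc Uᵀ U, hUU, Matrix.one_mul]
  rw [exp_conj_diagonal hU, Matrix.mul_sub, trace_sub, hAA, htr, htr, trace_conj_diagonal_mul,
    ← sum_dotProduct_mulVec_eq_trace hq, ← Finset.sum_sub_distrib, ← Finset.sum_add_distrib]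
  exact Finset.sum_le_sum fun i _ => (Eq.le (by ring)).trans
    (exp_mul_le_dotProduct_exp hB (a i) (Uᵀ i))

theorem convexOn_trace_exp : ConvexOn ℝ Set.univ
    fun A : selfAdjoint (Matrix ι ι ℝ) => (NormedSpace.exp (A : Matrix ι ι ℝ)).trace := by
  refine ⟨convex_univ, fun A _ B _ a b ha hb hab => ?_⟩
  set C := a • A + b • B with hC
  have hA := trace_exp_add_trace_exp_mul_sub_le C.2 A.2
  have hB := trace_exp_add_trace_exp_mul_sub_le C.2 B.2
  have hbal : a * (NormedSpace.exp (C : Matrix ι ι ℝ) * (A - C)).trace +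
      b * (NormedSpace.exp (C : Matrix ι ι ℝ) * (B - C)).trace = 0 := by
    have : a • ((A : Matrix ι ι ℝ) - C) + b • ((B : Matrix ι ι ℝ) - C) = 0 := by
      rw [smul_sub, smul_sub, sub_add_sub_comm, ← add_smul, hab, one_smul, hC]
      simp
    calc _ = (NormedSpace.exp (C : Matrix ι ι ℝ) * (a • (A - C) + b • (B - C))).trace := by
          simp only [Matrix.mul_add, Matrix.mul_smul, trace_add, trace_smul, smul_eq_mul]
      _ = 0 := by rw [this, Matrix.mul_zero, trace_zero]
  calc _ = a * (NormedSpace.exp (C : Matrix ι ι ℝ)).trace +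
        b * (NormedSpace.exp (C : Matrix ι ι ℝ)).trace := by rw [← add_mul, hab, one_mul]
    _ ≤ _ := by
      simp only [smul_eq_mul]
      linarith [mul_le_mul_of_nonneg_left hA ha, mul_le_mul_of_nonneg_left hB hb]

theorem dotProduct_exp_le_mul_trace_exp {A : Matrix ι ι ℝ} (hA : A.IsHermitian) (x : ι → ℝ) :
    x ⬝ᵥ NormedSpace.exp A *ᵥ x ≤ (x ⬝ᵥ x) * (NormedSpace.exp A).trace := by
  obtain ⟨U, hU, a, rfl⟩ := exists_orthogonal_diagonalization hA
  have htr : (U * diagonal (fun i => Real.exp (a i)) * Uᵀ).trace = ∑ i, Real.exp (a i) := by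
    rw [trace_mul_comm, ← Matrix.mul_assoc, (mem_orthogonalGroup_iff' ι ℝ).1 hU, Matrix.one_mul,
      trace_diagonal]
  rw [exp_conj_diagonal hU, dotProduct_conj_diagonal, htr, ← sum_transpose_mulVec_sq hU,
    Finset.mul_sum]
  refine Finset.sum_le_sum fun i _ => ?_
  rw [mul_comm]
  gcongr
  exact Finset.single_le_sum (f := fun i => (Uᵀ *ᵥ x) i ^ 2) (fun j _ => sq_nonneg _)
    (Finset.mem_univ i)

theorem exp_le_trace_exp {A : Matrix ι ι ℝ} (hA : A.IsHermitian) {x : ι → ℝ} {t : ℝ}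
    (ht : t * (x ⬝ᵥ x) < x ⬝ᵥ A *ᵥ x) : Real.exp t ≤ (NormedSpace.exp A).trace := by
  have hx : 0 < x ⬝ᵥ x := by
    refine (dotProduct_self_star_nonneg x).lt_of_ne' fun h => ?_
    simp [dotProduct_self_eq_zero.1 h] at ht
  refine le_of_mul_le_mul_left ?_ hx
  calc (x ⬝ᵥ x) * Real.exp t ≤ Real.exp t * (x ⬝ᵥ x + (x ⬝ᵥ A *ᵥ x - t * (x ⬝ᵥ x))) := by
        rw [mul_comm]
        gcongr
        linarith
    _ ≤ x ⬝ᵥ NormedSpace.exp A *ᵥ x := exp_mul_le_dotProduct_exp hA t x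
    _ ≤ _ := dotProduct_exp_le_mul_trace_exp hA x

/-! ### Rank-one updates -/

theorem sum_mul_sum_le_sum_mul_sum_of_monovary {w f g : κ → ℝ}
    (hw : ∀ i, 0 ≤ w i) (hfg : Monovary f g) :
    (∑ i, f i * w i) * ∑ i, g i * w i ≤ (∑ i, w i) * ∑ i, f i * g i * w i := by
  have hnonneg : 0 ≤ ∑ i, ∑ j, w i * w j * ((f i - f j) * (g i - g j)) :=
    Finset.sum_nonneg fun i _ => Finset.sum_nonneg fun j _ =>
      mul_nonneg (mul_nonneg (hw i) (hw j)) (monovary_iff_forall_mul_nonneg.1 hfg j i)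
  have hexpand : ∑ i, ∑ j, w i * w j * ((f i - f j) * (g i - g j)) =
      (∑ i, f i * g i * w i) * (∑ j, w j) + (∑ i, w i) * (∑ j, f j * g j * w j)
        - (∑ i, f i * w i) * (∑ j, g j * w j) - (∑ i, g i * w i) * (∑ j, f j * w j) := by
    simp_rw [Finset.sum_mul_sum, ← Finset.sum_add_distrib, ← Finset.sum_sub_distrib]
    exact Finset.sum_congr rfl fun i _ => Finset.sum_congr rfl fun j _ => by ring
  linarith [mul_comm (∑ i, w i) (∑ i, f i * g i * w i),
    mul_comm (∑ i, g i * w i) (∑ i, f i * w i)]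

theorem monovary_pow_add_pow {β : Type*} {a : β → ℝ} (ha : ∀ i, 0 ≤ a i) {c : ℝ} (hc : 0 ≤ c)
    (k N : ℕ) : Monovary (fun i => a i ^ k) (fun i => (a i + c) ^ N) := by
  intro i j hij
  have hlt : a i + c < a j + c := lt_of_pow_lt_pow_left₀ N (add_nonneg (ha j) hc) hij
  exact pow_le_pow_left₀ (ha i) (le_of_add_le_add_right hlt.le) k

-- Expanding one factor `A + s • x xᵀ` raises the power of `A` on the left, hence the general `k`.
theorem dotProduct_pow_mul_add_smul_vecMulVec_pow_le {U : Matrix ι ι ℝ}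
    (hU : U ∈ orthogonalGroup ι ℝ) {a : ι → ℝ} (ha : ∀ i, 0 ≤ a i) {s : ℝ} (hs : 0 ≤ s)
    (x : ι → ℝ) (N k : ℕ) :
    x ⬝ᵥ ((U * diagonal a * Uᵀ) ^ k * (U * diagonal a * Uᵀ + s • vecMulVec x x) ^ N) *ᵥ x ≤
      ∑ i, a i ^ k * (a i + s * (x ⬝ᵥ x)) ^ N * (Uᵀ *ᵥ x) i ^ 2 := by
  have hx : 0 ≤ x ⬝ᵥ x := dotProduct_self_star_nonneg x
  have hpow : ∀ k, x ⬝ᵥ (U * diagonal a * Uᵀ) ^ k *ᵥ x = ∑ i, a i ^ k * (Uᵀ *ᵥ x) i ^ 2 :=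
    fun k => by rw [pow_conj_diagonal hU, dotProduct_conj_diagonal]
  induction N generalizing k with
  | zero => simp [hpow]
  | succ N ih =>
    set A := U * diagonal a * Uᵀ
    set C := A + s • vecMulVec x x
    have hsplit : A ^ k * C ^ (N + 1) = A ^ (k + 1) * C ^ N +
        s • (A ^ k * vecMulVec x x * C ^ N) := by
      rw [pow_succ' C, ← Matrix.mul_assoc, show C = A + s • vecMulVec x x from rfl,
        Matrix.mul_add, Matrix.add_mul, ← pow_succ, Matrix.mul_smul, Matrix.smul_mul]
    have hrank_one : (x ⬝ᵥ A ^ k *ᵥ x) * (x ⬝ᵥ C ^ N *ᵥ x) ≤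
        (x ⬝ᵥ x) * ∑ i, a i ^ k * (a i + s * (x ⬝ᵥ x)) ^ N * (Uᵀ *ᵥ x) i ^ 2 :=
      calc _ ≤ (∑ i, a i ^ k * (Uᵀ *ᵥ x) i ^ 2) *
            ∑ i, (a i + s * (x ⬝ᵥ x)) ^ N * (Uᵀ *ᵥ x) i ^ 2 := by
            rw [hpow]
            refine mul_le_mul_of_nonneg_left (by simpa using ih 0) (Finset.sum_nonneg fun i _ => ?_)
            exact mul_nonneg (pow_nonneg (ha i) k) (sq_nonneg _)
        _ ≤ _ := by
            rw [← sum_transpose_mulVec_sq hU x] at hx ⊢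
            exact sum_mul_sum_le_sum_mul_sum_of_monovary (fun i => sq_nonneg _)
              (monovary_pow_add_pow ha (mul_nonneg hs hx) k N)
    rw [hsplit, add_mulVec, dotProduct_add, smul_mulVec, dotProduct_smul, smul_eq_mul,
      dotProduct_mul_vecMulVec_mul]
    refine (add_le_add (ih (k + 1)) (mul_le_mul_of_nonneg_left hrank_one hs)).trans (Eq.le ?_)
    rw [← mul_assoc, Finset.mul_sum, ← Finset.sum_add_distrib]
    exact Finset.sum_congr rfl fun i _ => by ring

theorem hasSum_sum_exp_mul (a w : κ → ℝ) :
    HasSum (fun N : ℕ => (N.factorial : ℝ)⁻¹ * ∑ i, a i ^ N * w i)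
      (∑ i, Real.exp (a i) * w i) := by
  simp_rw [Finset.mul_sum, Real.exp_eq_exp_ℝ, ← mul_assoc]
  exact hasSum_sum fun i _ => (NormedSpace.exp_series_hasSum_exp' (𝕂 := ℝ) (a i)).mul_right (w i)

theorem hasSum_dotProduct_exp {B : Matrix ι ι ℝ} (hB : B.IsHermitian) (x : ι → ℝ) :
    HasSum (fun N : ℕ => (N.factorial : ℝ)⁻¹ * (x ⬝ᵥ B ^ N *ᵥ x))
      (x ⬝ᵥ NormedSpace.exp B *ᵥ x) := by
  obtain ⟨V, hV, b, rfl⟩ := exists_orthogonal_diagonalization hB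
  simp_rw [exp_conj_diagonal hV, pow_conj_diagonal hV, dotProduct_conj_diagonal]
  exact hasSum_sum_exp_mul b _

theorem dotProduct_exp_add_smul_vecMulVec_le_of_posSemidef {A : Matrix ι ι ℝ}
    (hA : A.PosSemidef) {s : ℝ} (hs : 0 ≤ s) (x : ι → ℝ) :
    x ⬝ᵥ NormedSpace.exp (A + s • vecMulVec x x) *ᵥ x ≤
      Real.exp (s * (x ⬝ᵥ x)) * (x ⬝ᵥ NormedSpace.exp A *ᵥ x) := by
  have hsum := hasSum_dotProduct_exp (hA.isHermitian.add (isHermitian_smul_vecMulVec s x)) x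
  obtain ⟨U, hU, a, rfl⟩ := exists_orthogonal_diagonalization hA.isHermitian
  have ha : ∀ i, 0 ≤ a i := by
    have h := hA.conjTranspose_mul_mul_same U
    rwa [conjTranspose_eq_transpose_of_trivial, Matrix.mul_assoc, Matrix.mul_assoc,
      (mem_orthogonalGroup_iff' ι ℝ).1 hU, Matrix.mul_one, ← Matrix.mul_assoc,
      (mem_orthogonalGroup_iff' ι ℝ).1 hU, Matrix.one_mul, posSemidef_diagonal_iff] at h
  have hmoment : ∀ N, x ⬝ᵥ (U * diagonal a * Uᵀ + s • vecMulVec x x) ^ N *ᵥ x ≤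
      ∑ i, (a i + s * (x ⬝ᵥ x)) ^ N * (Uᵀ *ᵥ x) i ^ 2 := fun N => by
    simpa using dotProduct_pow_mul_add_smul_vecMulVec_pow_le hU ha hs x N 0
  have hsum' := hasSum_sum_exp_mul (fun i => a i + s * (x ⬝ᵥ x)) fun i => (Uᵀ *ᵥ x) i ^ 2
  refine (hasSum_le (fun N => mul_le_mul_of_nonneg_left (hmoment N) (by positivity))
    hsum hsum').trans (Eq.le ?_)
  rw [exp_conj_diagonal hU, dotProduct_conj_diagonal, Finset.mul_sum]
  exact Finset.sum_congr rfl fun i _ => by rw [Real.exp_add]; ring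

theorem exists_posSemidef_add_smul_one {β : Type*} [Finite β] [DecidableEq β] {A : Matrix β β ℝ}
    (hA : A.IsHermitian) : ∃ c : ℝ, (A + c • 1).PosSemidef := by
  cases nonempty_fintype β
  obtain ⟨U, hU, a, rfl⟩ := exists_orthogonal_diagonalization hA
  obtain ⟨c, hc⟩ := (Set.finite_range fun i => -a i).bddAbove
  refine ⟨c, ?_⟩
  have hdiag : U * diagonal a * Uᵀ + c • 1 = U * diagonal (fun i => a i + c) * Uᵀ := by
    rw [← diagonal_add, ← smul_one_eq_diagonal, Matrix.mul_add, Matrix.add_mul, Matrix.mul_smul,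
      Matrix.mul_one, Matrix.smul_mul, (mem_orthogonalGroup_iff β ℝ).1 hU]
  rw [hdiag]
  exact (posSemidef_diagonal_iff.2 fun i =>
    neg_le_iff_add_nonneg'.1 (hc ⟨i, rfl⟩)).mul_mul_conjTranspose_same U

theorem dotProduct_exp_add_smul_vecMulVec_le {A : Matrix ι ι ℝ} (hA : A.IsHermitian)
    {s : ℝ} (hs : 0 ≤ s) (x : ι → ℝ) :
    x ⬝ᵥ NormedSpace.exp (A + s • vecMulVec x x) *ᵥ x ≤
      Real.exp (s * (x ⬝ᵥ x)) * (x ⬝ᵥ NormedSpace.exp A *ᵥ x) := by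
  -- A shift of `A` by `c` multiplies both sides by `exp c`.
  obtain ⟨c, hc⟩ := exists_posSemidef_add_smul_one hA
  have h := dotProduct_exp_add_smul_vecMulVec_le_of_posSemidef hc hs x
  rw [add_right_comm, exp_add_smul_one, exp_add_smul_one, smul_mulVec, smul_mulVec,
    dotProduct_smul, dotProduct_smul, smul_eq_mul, smul_eq_mul, mul_left_comm] at h
  exact le_of_mul_le_mul_left h (Real.exp_pos c)

theorem trace_exp_add_smul_vecMulVec_le {A : Matrix ι ι ℝ} (hA : A.IsHermitian)
    (θ : ℝ) (x : ι → ℝ) :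
    (NormedSpace.exp (A + θ • vecMulVec x x)).trace ≤ (NormedSpace.exp A).trace +
      θ * Real.exp (θ * (x ⬝ᵥ x)) * (x ⬝ᵥ NormedSpace.exp A *ᵥ x) := by
  have hB := hA.add (isHermitian_smul_vecMulVec θ x)
  set B := A + θ • vecMulVec x x with hBdef
  have hAB : A = B + (-θ) • vecMulVec x x := by rw [hBdef, neg_smul, add_neg_cancel_right]
  -- Using the tangent at the updated matrix `B` avoids the Golden-Thompson inequality.
  have hklein := trace_exp_add_trace_exp_mul_sub_le hB hA
  nth_rw 1 [hAB] at hklein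
  rw [add_sub_cancel_left, Matrix.mul_smul, trace_smul, smul_eq_mul, trace_mul_vecMulVec]
    at hklein
  have hupdate : θ * (x ⬝ᵥ NormedSpace.exp B *ᵥ x) ≤
      θ * (Real.exp (θ * (x ⬝ᵥ x)) * (x ⬝ᵥ NormedSpace.exp A *ᵥ x)) := by
    rcases le_total 0 θ with hθ | hθ
    · exact mul_le_mul_of_nonneg_left (dotProduct_exp_add_smul_vecMulVec_le hA hθ x) hθ
    · refine mul_le_mul_of_nonpos_left ?_ hθ
      have h := dotProduct_exp_add_smul_vecMulVec_le hB (neg_nonneg.2 hθ) x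
      rw [← hAB, neg_mul, Real.exp_neg] at h
      exact (le_inv_mul_iff₀ (Real.exp_pos _)).1 h
  linarith

theorem expect_trace_exp_add_smul_vecMulVec_le {A : Matrix ι ι ℝ} (hA : A.IsHermitian)
    (θ : ℝ) {q : κ → ι → ℝ} (hq : ∑ j, vecMulVec (q j) (q j) = 1) {R : ℝ}
    (hR : ∀ j, q j ⬝ᵥ q j ≤ R) :
    𝔼 j, (NormedSpace.exp (A + θ • vecMulVec (q j) (q j))).trace ≤
      Real.exp (θ * Real.exp (θ * R) / Fintype.card κ) * (NormedSpace.exp A).trace := by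
  have htr := (posSemidef_exp hA).trace_nonneg
  rcases isEmpty_or_nonempty κ with hκ | hκ
  · simpa using htr
  have hstep : ∀ j, (NormedSpace.exp (A + θ • vecMulVec (q j) (q j))).trace ≤
      (NormedSpace.exp A).trace + θ * Real.exp (θ * R) * (q j ⬝ᵥ NormedSpace.exp A *ᵥ q j) :=
    fun j => by
    refine (trace_exp_add_smul_vecMulVec_le hA θ (q j)).trans ?_
    have hquad : 0 ≤ q j ⬝ᵥ NormedSpace.exp A *ᵥ q j :=
      (posSemidef_exp hA).dotProduct_mulVec_nonneg (q j)
    have hrate : θ * Real.exp (θ * (q j ⬝ᵥ q j)) ≤ θ * Real.exp (θ * R) := by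
      rcases le_total 0 θ with hθ | hθ
      · have := hR j
        gcongr
      · exact mul_le_mul_of_nonpos_left
          (Real.exp_le_exp.2 (mul_le_mul_of_nonpos_left (hR j) hθ)) hθ
    gcongr
  calc _ ≤ 𝔼 j, ((NormedSpace.exp A).trace +
        θ * Real.exp (θ * R) * (q j ⬝ᵥ NormedSpace.exp A *ᵥ q j)) :=
        Finset.expect_le_expect fun j _ => hstep j
    _ = (θ * Real.exp (θ * R) / Fintype.card κ + 1) * (NormedSpace.exp A).trace := by
        rw [Finset.expect_add_distrib, Fintype.expect_const, ← Finset.mul_expect,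
          Fintype.expect_eq_sum_div_card, sum_dotProduct_mulVec_eq_trace hq]
        ring
    _ ≤ _ := by gcongr; exact Real.add_one_le_exp _

end TraceExp

section SamplingWithoutReplacement

open Matrix
open scoped BigOperators

variable {α : Type*} [Fintype α] {m : ℕ}

theorem sum_embedding_succ_add (H : (Fin m ↪ α) → α → ℝ) :
    ∑ e : Fin (m + 1) ↪ α, H (Fin.Embedding.tail e) (e 0) + ∑ e : Fin m ↪ α, ∑ s, H e (e s) =
      ∑ e : Fin m ↪ α, ∑ j, H e j := by
  classical
  have hnew : ∑ e : Fin (m + 1) ↪ α, H (Fin.Embedding.tail e) (e 0) =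
      ∑ e : Fin m ↪ α, ∑ j : {j // j ∉ Set.range e}, H e j := by
    rw [← Fintype.sum_sigma', ← (Equiv.embeddingFinSucc m α).sum_comp]
    rfl
  rw [hnew, ← Finset.sum_add_distrib]
  refine Finset.sum_congr rfl fun e _ => ?_
  rw [← Fintype.sum_subtype_add_sum_subtype (fun j => j ∈ Set.range e), add_comm]
  congr 1
  convert (Equiv.ofInjective e e.injective).sum_comp fun j => H e j
  rfl

theorem card_embedding_succ (hm : m < Fintype.card α) :
    (Fintype.card (Fin (m + 1) ↪ α) : ℝ) =
      (Fintype.card α - m) * Fintype.card (Fin m ↪ α) := by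
  simp [Fintype.card_embedding_eq, Nat.descFactorial_succ, Nat.cast_sub hm.le]

theorem card_embedding_pos (hm : m ≤ Fintype.card α) : 0 < Fintype.card (Fin m ↪ α) := by
  simpa [Fintype.card_embedding_eq, Nat.pos_iff_ne_zero, Nat.descFactorial_eq_zero_iff_lt] using hm

theorem card_mul_expect_expect_embedding (hm : m < Fintype.card α) (H : (Fin m ↪ α) → α → ℝ) :
    Fintype.card α * 𝔼 e : Fin m ↪ α, 𝔼 j, H e j =
      (Fintype.card α - m) * 𝔼 e : Fin (m + 1) ↪ α, H (Fin.Embedding.tail e) (e 0) +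
        ∑ s, 𝔼 e : Fin m ↪ α, H e (e s) := by
  have hm' : (0 : ℝ) < Fintype.card α - m := sub_pos.2 (by exact_mod_cast hm)
  have hcard : (0 : ℝ) < Fintype.card (Fin m ↪ α) := by exact_mod_cast card_embedding_pos hm.le
  rw [Finset.mul_expect, ← Finset.expect_sum_comm]
  simp_rw [Fintype.card_mul_expect, Fintype.expect_eq_sum_div_card]
  rw [← sum_embedding_succ_add, card_embedding_succ hm]
  field_simp

theorem expect_embedding_tail (hm : m < Fintype.card α) (h : (Fin m ↪ α) → ℝ) :
    𝔼 e : Fin (m + 1) ↪ α, h (Fin.Embedding.tail e) = 𝔼 e, h e := by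
  have : Nonempty α := Fintype.card_pos_iff.1 (Nat.zero_lt_of_lt hm)
  have hm' : (Fintype.card α - m : ℝ) ≠ 0 := (sub_pos.2 (by exact_mod_cast hm)).ne'
  have h := card_mul_expect_expect_embedding hm fun e _ => h e
  simp only [Fintype.expect_const, Finset.sum_const, Finset.card_univ, Fintype.card_fin,
    nsmul_eq_mul] at h
  exact mul_left_cancel₀ hm' (by linarith)

variable {E : Type*} [AddCommGroup E] [Module ℝ E] {f : E → ℝ}

theorem expect_embedding_le_expect_replace (hf : ConvexOn ℝ Set.univ f) (X : α → E)
    (s t : Fin m) :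
    𝔼 e : Fin m ↪ α, f (∑ i, X (e i)) ≤
      𝔼 e : Fin m ↪ α, f (∑ i, X (e i) - X (e s) + X (e t)) := by
  have hswap : 𝔼 e : Fin m ↪ α, f (∑ i, X (e i) - X (e s) + X (e t)) =
      𝔼 e : Fin m ↪ α, f (∑ i, X (e i) - X (e t) + X (e s)) := by
    refine Fintype.expect_equiv ((Equiv.swap s t).embeddingCongr (Equiv.refl α)) _ _ fun e => ?_
    have he : ∀ i, (Equiv.swap s t).embeddingCongr (Equiv.refl α) e i = e (Equiv.swap s t i) :=
      fun i => by simp [Equiv.embeddingCongr]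
    simp_rw [he, Equiv.swap_apply_left, Equiv.swap_apply_right]
    rw [Equiv.sum_comp (Equiv.swap s t) fun i => X (e i)]
  have hmid : ∀ S D : E, f S ≤ (f (S - D) + f (S + D)) / 2 := fun S D => by
    have h := hf.2 (Set.mem_univ (S - D)) (Set.mem_univ (S + D))
      (by norm_num : (0 : ℝ) ≤ 1 / 2) (by norm_num : (0 : ℝ) ≤ 1 / 2) (by norm_num)
    rw [← smul_add, sub_add_add_cancel, ← two_smul ℝ S, smul_smul] at h
    norm_num at h
    linarith
  calc 𝔼 e : Fin m ↪ α, f (∑ i, X (e i))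
      ≤ 𝔼 e : Fin m ↪ α, (f (∑ i, X (e i) - X (e s) + X (e t)) +
          f (∑ i, X (e i) - X (e t) + X (e s))) / 2 :=
        Finset.expect_le_expect fun e _ =>
          (hmid _ (X (e s) - X (e t))).trans_eq (by congr 3 <;> abel)
    _ = 𝔼 e : Fin m ↪ α, f (∑ i, X (e i) - X (e s) + X (e t)) := by
        rw [← Finset.expect_div, Finset.expect_add_distrib, ← hswap, add_self_div_two]

-- One step of Hoeffding's comparison: the average over `j` splits into fresh draws and repetitions
-- of an earlier draw, and by convexity a repetition only increases the mean.
theorem expect_embedding_succ_le (hf : ConvexOn ℝ Set.univ f) (X : α → E)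
    (hm : m < Fintype.card α) :
    𝔼 e : Fin (m + 1) ↪ α, f (∑ i, X (e i)) ≤
      𝔼 e : Fin m ↪ α, 𝔼 j, f (∑ i, X (e i) + X j) := by
  have htail : ∀ e : Fin (m + 1) ↪ α,
      ∑ i, X (e i) = ∑ i, X (Fin.Embedding.tail e i) + X (e 0) := fun e => by
    rw [Fin.sum_univ_succ, add_comm]; rfl
  have hrepeat : ∀ s : Fin m, 𝔼 e : Fin (m + 1) ↪ α, f (∑ i, X (e i)) ≤
      𝔼 e : Fin m ↪ α, f (∑ i, X (e i) + X (e s)) := fun s => by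
    refine (expect_embedding_le_expect_replace hf X 0 s.succ).trans_eq ?_
    rw [← expect_embedding_tail hm fun e => f (∑ i, X (e i) + X (e s))]
    refine Finset.expect_congr rfl fun e _ => ?_
    rw [htail, add_sub_cancel_right]
    rfl
  have hcard : (0 : ℝ) < Fintype.card α := by exact_mod_cast Nat.zero_lt_of_lt hm
  refine le_of_mul_le_mul_left ?_ hcard
  rw [card_mul_expect_expect_embedding hm fun e j => f (∑ i, X (e i) + X j)]
  simp_rw [← htail]
  have hsum := Finset.sum_le_sum fun s (_ : s ∈ Finset.univ) => hrepeat s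
  rw [Finset.sum_const, Finset.card_univ, nsmul_eq_mul, Fintype.card_fin] at hsum
  linarith

theorem expect_embedding_le_pow_mul (hf : ConvexOn ℝ Set.univ f) (hf0 : 0 ≤ f 0) (X : α → E)
    {c : ℝ} (hc : 0 ≤ c) (hstep : ∀ S, 𝔼 j, f (S + X j) ≤ c * f S) (m : ℕ) :
    𝔼 e : Fin m ↪ α, f (∑ i, X (e i)) ≤ c ^ m * f 0 := by
  induction m with
  | zero => simp
  | succ m ih =>
    rcases Nat.lt_or_ge m (Fintype.card α) with hm | hm
    · calc 𝔼 e : Fin (m + 1) ↪ α, f (∑ i, X (e i))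
          ≤ 𝔼 e : Fin m ↪ α, 𝔼 j, f (∑ i, X (e i) + X j) := expect_embedding_succ_le hf X hm
        _ ≤ 𝔼 e : Fin m ↪ α, c * f (∑ i, X (e i)) :=
          Finset.expect_le_expect fun e _ => hstep _
        _ = c * 𝔼 e : Fin m ↪ α, f (∑ i, X (e i)) := (Finset.mul_expect ..).symm
        _ ≤ c * (c ^ m * f 0) := by gcongr
        _ = c ^ (m + 1) * f 0 := by ring
    · have : IsEmpty (Fin (m + 1) ↪ α) := by
        rw [← Fintype.card_eq_zero_iff, Fintype.card_embedding_eq]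
        exact Nat.descFactorial_eq_zero_iff_lt.2 (by simpa using Nat.lt_succ_of_le hm)
      simpa using mul_nonneg (pow_nonneg hc _) hf0

variable {ι : Type*} [Fintype ι] [DecidableEq ι]

theorem expect_embedding_trace_exp_le {q : α → ι → ℝ} (hq : ∑ j, vecMulVec (q j) (q j) = 1)
    {R : ℝ} (hR : ∀ j, q j ⬝ᵥ q j ≤ R) (θ : ℝ) (m : ℕ) :
    𝔼 e : Fin m ↪ α, (NormedSpace.exp (∑ i, θ • vecMulVec (q (e i)) (q (e i)))).trace ≤
      Real.exp (m * (θ * Real.exp (θ * R) / Fintype.card α)) * Fintype.card ι := by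
  let X : α → selfAdjoint (Matrix ι ι ℝ) := fun j =>
    ⟨θ • vecMulVec (q j) (q j), isHermitian_smul_vecMulVec θ (q j)⟩
  have h := expect_embedding_le_pow_mul convexOn_trace_exp
    (posSemidef_exp isHermitian_zero).trace_nonneg X (Real.exp_pos _).le
    (fun S => expect_trace_exp_add_smul_vecMulVec_le S.2 θ hq hR) m
  simpa [X, ← Real.exp_nat_mul] using h

theorem integral_uniformOn_injective {ρ : ℕ} [MeasurableSpace α] [DiscreteMeasurableSpace α]
    (F : (Fin ρ → α) → ℝ) :
    ∫ ω, F ω ∂uniformOn {ω : Fin ρ → α | Function.Injective ω} = 𝔼 e : Fin ρ ↪ α, F e := by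
  classical
  have hinj : Function.Injective ((⇑) : (Fin ρ ↪ α) → Fin ρ → α) := DFunLike.coe_injective
  have himage : {ω : Fin ρ → α | Function.Injective ω} =
      (Finset.univ.image ((⇑) : (Fin ρ ↪ α) → Fin ρ → α) : Set (Fin ρ → α)) := by
    ext ω
    simpa using ⟨fun h => ⟨⟨ω, h⟩, rfl⟩, fun ⟨e, he⟩ => he ▸ e.injective⟩
  rw [himage, uniformOn, ProbabilityTheory.cond, integral_smul_measure,
    setIntegral_finset _ Integrable.of_finite.integrableOn,
    Measure.count_apply_finset, Finset.card_image_of_injective _ hinj,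
    Finset.sum_image hinj.injOn, Fintype.expect_eq_sum_div_card, div_eq_inv_mul]
  simp

theorem uniformOn_injective_exists_lt_le {ρ : ℕ} [MeasurableSpace α] [DiscreteMeasurableSpace α]
    {q : α → ι → ℝ} (hq : ∑ j, vecMulVec (q j) (q j) = 1)
    {R : ℝ} (hR : ∀ j, q j ⬝ᵥ q j ≤ R) (θ t : ℝ) :
    (uniformOn {ω : Fin ρ → α | Function.Injective ω}).real
        {ω | ∃ z, t * (z ⬝ᵥ z) < θ * ∑ i, (q (ω i) ⬝ᵥ z) ^ 2} ≤
      Fintype.card ι * Real.exp (ρ * (θ * Real.exp (θ * R) / Fintype.card α) - t) := by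
  set μ := uniformOn {ω : Fin ρ → α | Function.Injective ω}
  set F : (Fin ρ → α) → ℝ :=
    fun ω => (NormedSpace.exp (∑ i, θ • vecMulVec (q (ω i)) (q (ω i)))).trace
  have hherm : ∀ ω : Fin ρ → α, (∑ i, θ • vecMulVec (q (ω i)) (q (ω i))).IsHermitian := fun ω =>
    isSelfAdjoint_sum _ fun i _ => isHermitian_smul_vecMulVec θ (q (ω i))
  have hsub : {ω : Fin ρ → α | ∃ z, t * (z ⬝ᵥ z) < θ * ∑ i, (q (ω i) ⬝ᵥ z) ^ 2} ⊆
      {ω | Real.exp t ≤ F ω} := by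
    rintro ω ⟨z, hz⟩
    refine exp_le_trace_exp (hherm ω) (hz.trans_eq ?_)
    simp_rw [sum_mulVec, dotProduct_sum, dotProduct_smul_vecMulVec_mulVec, Finset.mul_sum]
  have hmarkov : Real.exp t * μ.real {ω | Real.exp t ≤ F ω} ≤ ∫ ω, F ω ∂μ :=
    mul_meas_ge_le_integral_of_nonneg (.of_forall fun ω => (posSemidef_exp (hherm ω)).trace_nonneg)
      .of_finite _
  have hmgf : ∫ ω, F ω ∂μ ≤
      Real.exp (ρ * (θ * Real.exp (θ * R) / Fintype.card α)) * Fintype.card ι :=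
    (integral_uniformOn_injective F).trans_le (expect_embedding_trace_exp_le hq hR θ ρ)
  rw [Real.exp_sub, mul_div_assoc', le_div_iff₀ (Real.exp_pos t), mul_comm,
    mul_comm (Fintype.card ι : ℝ)]
  exact (mul_le_mul_of_nonneg_left (measureReal_mono hsub) (Real.exp_pos t).le).trans
    (hmarkov.trans hmgf)

end SamplingWithoutReplacement

section SubspaceSampling

open Matrix

variable {n k ρ : ℕ}

/-- `ω` is a sampling frame for `V` with bounds `a` and `b` if the coordinates of any vector of `V`
selected by `ω`, rescaled by `n / ρ`, carry its energy up to the factors `a` and `b`. -/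
def IsSamplingFrame (V : Submodule ℝ (Fin n → ℝ)) (a b : ℝ) (ω : Fin ρ → Fin n) : Prop :=
  ∀ x ∈ V, a * ∑ j, x j ^ 2 ≤ (n / ρ : ℝ) * ∑ i, x (ω i) ^ 2 ∧
    (n / ρ : ℝ) * ∑ i, x (ω i) ^ 2 ≤ b * ∑ j, x j ^ 2

theorem mem_colSpan_iff {A : Matrix (Fin n) (Fin k) ℝ} {x : Fin n → ℝ} :
    x ∈ colSpan A ↔ ∃ z, A *ᵥ z = x := by
  rw [colSpan, ← Matrix.range_mulVecLin]
  rfl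

theorem sum_mulVec_sq {A : Matrix (Fin n) (Fin k) ℝ} (hA : Aᵀ * A = 1) (z : Fin k → ℝ) :
    ∑ j, (A *ᵥ z) j ^ 2 = z ⬝ᵥ z :=
  calc ∑ j, (A *ᵥ z) j ^ 2 = (A *ᵥ z) ⬝ᵥ (A *ᵥ z) := by simp [dotProduct, sq]
    _ = z ⬝ᵥ z := by
      rw [dotProduct_mulVec, ← mulVec_transpose, Matrix.mulVec_mulVec, hA, one_mulVec]

theorem row_dotProduct_self_le (A : Matrix (Fin n) (Fin k) ℝ) (j : Fin n) :
    A j ⬝ᵥ A j ≤ cumulativeCoherence A ^ 2 / n := by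
  have hn : (0 : ℝ) < n := by exact_mod_cast j.pos
  have h : √(n : ℝ) * ‖WithLp.toLp 2 (A.transpose.mulVec (Pi.single j 1))‖ ≤
      cumulativeCoherence A :=
    le_ciSup (f := fun i : Fin n => √(n : ℝ) *
      ‖WithLp.toLp 2 (A.transpose.mulVec (Pi.single i 1))‖) (Set.finite_range _).bddAbove j
  have hsq := pow_le_pow_left₀ (by positivity) h 2
  rw [mul_pow, Real.sq_sqrt hn.le, EuclideanSpace.real_norm_sq_eq] at hsq
  rw [le_div_iff₀' hn]
  simpa [dotProduct, sq] using hsq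

theorem natCast_le_cumulativeCoherence_sq {A : Matrix (Fin n) (Fin k) ℝ} (hA : Aᵀ * A = 1) :
    (k : ℝ) ≤ cumulativeCoherence A ^ 2 :=
  calc (k : ℝ) = ∑ j, A j ⬝ᵥ A j := by
        have h := congrArg trace ((sum_vecMulVec_row A).trans hA)
        simp_rw [trace_sum, trace_vecMulVec, trace_one, Fintype.card_fin] at h
        exact h.symm
    _ ≤ ∑ _j : Fin n, cumulativeCoherence A ^ 2 / n :=
        Finset.sum_le_sum fun j _ => row_dotProduct_self_le A j
    _ = n * (cumulativeCoherence A ^ 2 / n) := by simp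
    _ = cumulativeCoherence A ^ 2 * (n / n) := mul_div_left_comm ..
    _ ≤ cumulativeCoherence A ^ 2 := mul_le_of_le_one_right (sq_nonneg _) (div_self_le_one _)

theorem pos_of_cumulativeCoherence_sq_pos {A : Matrix (Fin n) (Fin k) ℝ}
    (hA : 0 < cumulativeCoherence A ^ 2) : 0 < n := by
  rcases Nat.eq_zero_or_pos n with rfl | hn
  · simp [cumulativeCoherence] at hA
  · exact hn

-- The sign of `τ` selects the tail: `0 < τ` gives the upper one and `τ < 0` the lower one.
theorem uniformOn_injective_energy_tail_le {A : Matrix (Fin n) (Fin k) ℝ} (hA : Aᵀ * A = 1)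
    (hk : 0 < k) (hρ : 0 < ρ) (τ a : ℝ) :
    (uniformOn {ω : Fin ρ → Fin n | Function.Injective ω}).real
        {ω | ∃ x ∈ colSpan A, τ * (a * ∑ j, x j ^ 2) < τ * ((n / ρ : ℝ) * ∑ i, x (ω i) ^ 2)} ≤
      k * Real.exp (-(ρ / cumulativeCoherence A ^ 2 * (τ * (a - Real.exp τ)))) := by
  set N := cumulativeCoherence A ^ 2 with hN
  have hN0 : 0 < N := (Nat.cast_pos.2 hk).trans_le (natCast_le_cumulativeCoherence_sq hA)
  have hn : (0 : ℝ) < n := Nat.cast_pos.2 (pos_of_cumulativeCoherence_sq_pos hN0)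
  have : (0 : ℝ) < ρ := Nat.cast_pos.2 hρ
  have htail := uniformOn_injective_exists_lt_le (ρ := ρ) ((sum_vecMulVec_row A).trans hA)
    (row_dotProduct_self_le A) (τ / (N / n)) (ρ / N * (τ * a))
  rw [← hN, div_mul_cancel₀ τ (div_pos hN0 hn).ne', Fintype.card_fin, Fintype.card_fin] at htail
  refine (measureReal_mono ?_).trans (htail.trans_eq ?_)
  · rintro ω ⟨x, hx, hlt⟩
    obtain ⟨z, rfl⟩ := mem_colSpan_iff.1 hx
    rw [sum_mulVec_sq hA] at hlt
    refine ⟨z, ?_⟩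
    calc ρ / N * (τ * a) * (z ⬝ᵥ z) = ρ / N * (τ * (a * (z ⬝ᵥ z))) := by ring
      _ < ρ / N * (τ * (n / ρ * ∑ i, (A *ᵥ z) (ω i) ^ 2)) := by gcongr
      _ = τ / (N / n) * ∑ i, (A *ᵥ z) (ω i) ^ 2 := by field_simp
  · congr 2
    field_simp
    ring

theorem mul_exp_neg_le_div_four {N δ ε s r : ℝ} (hk : 0 < k) (hN : 0 < N) (hδ : 0 < δ)
    (hε : 0 < ε) (hs : 27 / δ ^ 2 * N * Real.log (4 * k / ε) ≤ s) (hr : δ ^ 2 / 27 ≤ r)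
    (hs0 : 0 ≤ s) : k * Real.exp (-(s / N * r)) ≤ ε / 4 := by
  have : (0 : ℝ) < k := Nat.cast_pos.2 hk
  have hlog : Real.log (4 * k / ε) ≤ s / N * r :=
    calc Real.log (4 * k / ε) = 27 / δ ^ 2 * N * Real.log (4 * k / ε) / N * (δ ^ 2 / 27) := by
          field_simp
      _ ≤ s / N * r := by gcongr
  calc k * Real.exp (-(s / N * r)) ≤ k * Real.exp (-Real.log (4 * k / ε)) := by gcongr
    _ = ε / 4 := by
      rw [Real.exp_neg, Real.exp_log (by positivity)]
      field_simp

theorem lower_tail_rate {δ : ℝ} (hδ : 0 ≤ δ) :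
    δ ^ 2 / 27 ≤ -(δ / 4) * (1 - δ / 2 - Real.exp (-(δ / 4))) := by
  have h := Real.add_one_le_exp (-(δ / 4))
  nlinarith [mul_le_mul_of_nonneg_left h hδ]

theorem upper_tail_rate {δ : ℝ} (hδ : 0 ≤ δ) (hδ1 : δ ≤ 1) :
    δ ^ 2 / 27 ≤ δ / 5 * (1 + 41 / 100 * δ - Real.exp (δ / 5)) := by
  have hexp : Real.exp (δ / 5) ≤ 1 + δ / 5 + 11 / 500 * δ ^ 2 := by
    have h := Real.exp_bound' (x := δ / 5) (by positivity) (by linarith) (n := 3) (by norm_num)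
    norm_num [Finset.sum_range_succ, Nat.factorial] at h
    nlinarith [mul_nonneg (sq_nonneg δ) (sub_nonneg.2 hδ1)]
  nlinarith [mul_le_mul_of_nonneg_left hexp hδ, mul_nonneg (sq_nonneg δ) (sub_nonneg.2 hδ1)]

-- The frame bounds are applied once to the rows and once to the columns: their squares satisfy
-- `1 - δ ≤ (1 - δ / 2) ^ 2` and `(1 + 41 / 100 * δ) ^ 2 ≤ 1 + δ`.
theorem uniformOn_injective_not_isSamplingFrame_le {A : Matrix (Fin n) (Fin k) ℝ}
    (hA : Aᵀ * A = 1) {δ ε : ℝ} (hδ : δ ∈ Set.Ioo 0 1) (hε : ε ∈ Set.Ioo 0 1)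
    (hρ : 27 / δ ^ 2 * cumulativeCoherence A ^ 2 * Real.log (4 * k / ε) ≤ ρ) :
    (uniformOn {ω : Fin ρ → Fin n | Function.Injective ω}).real
      {ω | ¬ IsSamplingFrame (colSpan A) (1 - δ / 2) (1 + 41 / 100 * δ) ω} ≤ ε / 2 := by
  obtain ⟨hδ0, hδ1⟩ := hδ
  obtain ⟨hε0, hε1⟩ := hε
  rcases Nat.eq_zero_or_pos k with rfl | hk
  · have hframe : ∀ ω : Fin ρ → Fin n,
        IsSamplingFrame (colSpan A) (1 - δ / 2) (1 + 41 / 100 * δ) ω := fun ω x hx => by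
      obtain ⟨z, rfl⟩ := mem_colSpan_iff.1 hx
      simp [mulVec_eq_sum]
    simpa [hframe] using (half_pos hε0).le
  have hN : 0 < cumulativeCoherence A ^ 2 :=
    (Nat.cast_pos.2 hk).trans_le (natCast_le_cumulativeCoherence_sq hA)
  have hlog : 0 < Real.log (4 * k / ε) := by
    have hk' : (1 : ℝ) ≤ k := by exact_mod_cast hk
    exact Real.log_pos ((lt_div_iff₀ hε0).2 (by linarith))
  have hρ0 : 0 < ρ := by exact_mod_cast (by positivity : (0 : ℝ) < _).trans_le hρ
  set μ := uniformOn {ω : Fin ρ → Fin n | Function.Injective ω}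
  let tail (τ a : ℝ) : Set (Fin ρ → Fin n) :=
    {ω | ∃ x ∈ colSpan A, τ * (a * ∑ j, x j ^ 2) < τ * ((n / ρ : ℝ) * ∑ i, x (ω i) ^ 2)}
  have hcover : {ω | ¬ IsSamplingFrame (colSpan A) (1 - δ / 2) (1 + 41 / 100 * δ) ω} ⊆
      tail (-(δ / 4)) (1 - δ / 2) ∪ tail (δ / 5) (1 + 41 / 100 * δ) := fun ω hω => by
    simp only [IsSamplingFrame, Set.mem_ofPred_eq, not_forall, not_and_or, not_le] at hω
    obtain ⟨x, hx, hlt | hlt⟩ := hω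
    · exact .inl ⟨x, hx, mul_lt_mul_of_neg_left hlt (by linarith)⟩
    · exact .inr ⟨x, hx, mul_lt_mul_of_pos_left hlt (by linarith)⟩
  have htail : ∀ {τ a : ℝ}, δ ^ 2 / 27 ≤ τ * (a - Real.exp τ) →
      μ.real (tail τ a) ≤ ε / 4 := fun hτ =>
    (uniformOn_injective_energy_tail_le hA hk hρ0 _ _).trans
      (mul_exp_neg_le_div_four hk hN hδ0 hε0 hρ hτ (Nat.cast_nonneg ρ))
  calc μ.real {ω | ¬ IsSamplingFrame (colSpan A) (1 - δ / 2) (1 + 41 / 100 * δ) ω}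
      ≤ μ.real (tail (-(δ / 4)) (1 - δ / 2)) + μ.real (tail (δ / 5) (1 + 41 / 100 * δ)) :=
        (measureReal_mono hcover).trans (measureReal_union_le _ _)
    _ ≤ ε / 4 + ε / 4 :=
      add_le_add (htail (lower_tail_rate hδ0.le)) (htail (upper_tail_rate hδ0.le hδ1.le))
    _ = ε / 2 := by ring

theorem measureReal_not_isSamplingFrame_le {A : Matrix (Fin n) (Fin k) ℝ} (hA : Aᵀ * A = 1)
    {S : Type*} [MeasurableSpace S] {μ : Measure S} {ω : S → Fin ρ → Fin n}
    (hω : IsUniformWithoutReplacement μ ω)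
    {δ ε : ℝ} (hδ : δ ∈ Set.Ioo 0 1) (hε : ε ∈ Set.Ioo 0 1)
    (hρ : 27 / δ ^ 2 * cumulativeCoherence A ^ 2 * Real.log (4 * k / ε) ≤ ρ) :
    μ.real {s | ¬ IsSamplingFrame (colSpan A) (1 - δ / 2) (1 + 41 / 100 * δ) (ω s)} ≤ ε / 2 := by
  have hlaw := HasLaw.measure_eq hω
    (p := fun ω => ¬ IsSamplingFrame (colSpan A) (1 - δ / 2) (1 + 41 / 100 * δ) ω)
    (Set.toFinite _).measurableSet
  exact (congrArg ENNReal.toReal hlaw).trans_le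
    (uniformOn_injective_not_isSamplingFrame_le hA hδ hε hρ)

theorem frobenius_norm_sq {κ ι : Type*} [Fintype κ] [Fintype ι] (Y : Matrix κ ι ℝ) :
    ‖Y‖ ^ 2 = ∑ i, ∑ j, Y i j ^ 2 := by
  rw [frobenius_norm_def, ← Real.sqrt_eq_rpow, Real.sq_sqrt (by positivity)]
  simp

variable {p ρr ρc : ℕ}

theorem rowSampling_mul_mul_colSampling_apply (ωr : Fin ρr → Fin p) (ωc : Fin ρc → Fin n)
    (Y : Matrix (Fin p) (Fin n) ℝ) (s : Fin ρr) (t : Fin ρc) :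
    (rowSampling ωr * Y * colSampling ωc) s t = Y (ωr s) (ωc t) := by
  simp [Matrix.mul_apply, rowSampling, colSampling]

theorem smul_frobenius_norm_sq_sampling (ωr : Fin ρr → Fin p) (ωc : Fin ρc → Fin n)
    (Y : Matrix (Fin p) (Fin n) ℝ) :
    (n * p : ℝ) / (ρr * ρc) * ‖rowSampling ωr * Y * colSampling ωc‖ ^ 2 =
      n / ρc * ∑ t, p / ρr * ∑ s, Y (ωr s) (ωc t) ^ 2 := by
  simp_rw [frobenius_norm_sq, rowSampling_mul_mul_colSampling_apply]
  rw [Finset.sum_comm, ← Finset.mul_sum, ← mul_assoc, div_mul_div_comm, mul_comm (ρr : ℝ)]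

theorem IsSamplingFrame.frobenius_bounds {V : Submodule ℝ (Fin p → ℝ)}
    {V' : Submodule ℝ (Fin n → ℝ)} {a b a' b' : ℝ} (ha : 0 ≤ a) (hb : 0 ≤ b)
    {ωr : Fin ρr → Fin p} {ωc : Fin ρc → Fin n}
    (hr : IsSamplingFrame V a b ωr) (hc : IsSamplingFrame V' a' b' ωc)
    {Y : Matrix (Fin p) (Fin n) ℝ} (hcol : ∀ j, Y.col j ∈ V) (hrow : ∀ i, Y.row i ∈ V') :
    a * a' * ‖Y‖ ^ 2 ≤
        (n * p : ℝ) / (ρr * ρc) * ‖rowSampling ωr * Y * colSampling ωc‖ ^ 2 ∧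
      (n * p : ℝ) / (ρr * ρc) * ‖rowSampling ωr * Y * colSampling ωc‖ ^ 2 ≤
        b * b' * ‖Y‖ ^ 2 := by
  have hswap : ∀ c : ℝ, c * ∑ i, (n / ρc : ℝ) * ∑ t, Y i (ωc t) ^ 2 =
      n / ρc * ∑ t, c * ∑ i, Y i (ωc t) ^ 2 := fun c => by
    rw [← Finset.mul_sum, ← Finset.mul_sum, Finset.sum_comm, mul_left_comm]
  have hsplit : ∀ c c' : ℝ, c * c' * ‖Y‖ ^ 2 = c * ∑ i, c' * ∑ j, Y i j ^ 2 := fun c c' => by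
    rw [frobenius_norm_sq, ← Finset.mul_sum, mul_assoc]
  rw [smul_frobenius_norm_sq_sampling, hsplit, hsplit]
  constructor
  · calc a * ∑ i, a' * ∑ j, Y i j ^ 2 ≤ a * ∑ i, (n / ρc : ℝ) * ∑ t, Y i (ωc t) ^ 2 := by
          gcongr _ * ∑ i, ?_ with i
          exact (hc _ (hrow i)).1
      _ = n / ρc * ∑ t, a * ∑ i, Y i (ωc t) ^ 2 := hswap a
      _ ≤ n / ρc * ∑ t, p / ρr * ∑ s, Y (ωr s) (ωc t) ^ 2 := by
          gcongr _ * ∑ t, ?_ with t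
          exact (hr _ (hcol (ωc t))).1
  · calc n / ρc * ∑ t, p / ρr * ∑ s, Y (ωr s) (ωc t) ^ 2
        ≤ n / ρc * ∑ t, b * ∑ i, Y i (ωc t) ^ 2 := by
          gcongr _ * ∑ t, ?_ with t
          exact (hr _ (hcol (ωc t))).2
      _ = b * ∑ i, (n / ρc : ℝ) * ∑ t, Y i (ωc t) ^ 2 := (hswap b).symm
      _ ≤ b * ∑ i, b' * ∑ j, Y i j ^ 2 := by
          gcongr _ * ∑ i, ?_ with i
          exact (hc _ (hrow i)).2

theorem firstCols_transpose_mul_self {Q : Matrix (Fin n) (Fin n) ℝ}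
    (hQ : Q ∈ Matrix.orthogonalGroup (Fin n) ℝ) (hk : k ≤ n) :
    (firstCols Q k hk)ᵀ * firstCols Q k hk = 1 := by
  rw [firstCols, transpose_submatrix, ← submatrix_mul _ _ _ id _ Function.bijective_id,
    (mem_orthogonalGroup_iff' (Fin n) ℝ).1 hQ, submatrix_one _ (Fin.castLE_injective hk)]

end SubspaceSampling

theorem theorem1_general {p n kr kc ρr ρc : ℕ}
    {A : Matrix (Fin p) (Fin kr) ℝ} {B : Matrix (Fin n) (Fin kc) ℝ}
    (hA : A.transpose * A = 1) (hB : B.transpose * B = 1)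
    {S : Type*} [MeasurableSpace S] {μ : Measure S} [IsProbabilityMeasure μ]
    {ωr : S → Fin ρr → Fin p} {ωc : S → Fin ρc → Fin n}
    (hωr : IsUniformWithoutReplacement μ ωr) (hωc : IsUniformWithoutReplacement μ ωc)
    {δ ε : ℝ} (hδ : δ ∈ Set.Ioo (0 : ℝ) 1) (hε : ε ∈ Set.Ioo (0 : ℝ) 1)
    (hρc : (ρc : ℝ) ≥ 27 / δ ^ 2 * cumulativeCoherence B ^ 2 * Real.log (4 * kc / ε))
    (hρr : (ρr : ℝ) ≥ 27 / δ ^ 2 * cumulativeCoherence A ^ 2 * Real.log (4 * kr / ε)) :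
    1 - ε ≤ μ.real {s | ∀ Y ∈ lowRankOnGraphs A B,
      (1 - δ) * ‖Y‖ ^ 2 ≤
          (n * p : ℝ) / (ρr * ρc) * ‖rowSampling (ωr s) * Y * colSampling (ωc s)‖ ^ 2 ∧
        (n * p : ℝ) / (ρr * ρc) * ‖rowSampling (ωr s) * Y * colSampling (ωc s)‖ ^ 2 ≤
          (1 + δ) * ‖Y‖ ^ 2} := by
  set good := {s | _}
  let badRows := {s | ¬ IsSamplingFrame (colSpan A) (1 - δ / 2) (1 + 41 / 100 * δ) (ωr s)}
  let badCols := {s | ¬ IsSamplingFrame (colSpan B) (1 - δ / 2) (1 + 41 / 100 * δ) (ωc s)}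
  have hrows : μ.real badRows ≤ ε / 2 := measureReal_not_isSamplingFrame_le hA hωr hδ hε hρr
  have hcols : μ.real badCols ≤ ε / 2 := measureReal_not_isSamplingFrame_le hB hωc hδ hε hρc
  obtain ⟨hδ0, hδ1⟩ := hδ
  have hcover : Set.univ ⊆ good ∪ (badRows ∪ badCols) := fun s _ => by
    by_contra hs
    simp only [Set.mem_union, not_or, badRows, badCols, Set.mem_ofPred_eq, not_not] at hs
    refine hs.1 fun Y hY => ?_
    obtain ⟨hlow, hupp⟩ :=
      hs.2.1.frobenius_bounds (by linarith) (by linarith) hs.2.2 hY.1 hY.2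
    exact ⟨hlow.trans' (by gcongr; nlinarith), hupp.trans (by gcongr; nlinarith)⟩
  have hunion : μ.real Set.univ ≤ μ.real good + μ.real (badRows ∪ badCols) :=
    (measureReal_mono hcover).trans (measureReal_union_le _ _)
  rw [probReal_univ] at hunion
  linarith [measureReal_union_le (μ := μ) badRows badCols]

theorem theorem1 {p n kr kc ρr ρc : ℕ}
    (Gr : WeightedGraph (Fin p)) (Gc : WeightedGraph (Fin n))
    (Lr P : Matrix (Fin p) (Fin p) ℝ) (lamr : Fin p → ℝ)
    (Lc Q : Matrix (Fin n) (Fin n) ℝ) (lamc : Fin n → ℝ)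
    (hLr : Gr.IsLaplacian Lr) (hLc : Gc.IsLaplacian Lc)
    (hP : IsSortedEigendecomposition Lr P lamr) (hQ : IsSortedEigendecomposition Lc Q lamc)
    (hkr : kr ≤ p) (hkc : kc ≤ n)
    {S : Type*} [MeasurableSpace S] (μ : Measure S) [IsProbabilityMeasure μ]
    (ωr : S → Fin ρr → Fin p) (ωc : S → Fin ρc → Fin n)
    (hωr : IsUniformWithoutReplacement μ ωr) (hωc : IsUniformWithoutReplacement μ ωc)
    (δ ε : ℝ) (hδ : δ ∈ Set.Ioo (0 : ℝ) 1) (hε : ε ∈ Set.Ioo (0 : ℝ) 1)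
    (hρc : (ρc : ℝ) ≥ 27 / δ ^ 2 * cumulativeCoherence (firstCols Q kc hkc) ^ 2 *
      Real.log (4 * kc / ε))
    (hρr : (ρr : ℝ) ≥ 27 / δ ^ 2 * cumulativeCoherence (firstCols P kr hkr) ^ 2 *
      Real.log (4 * kr / ε)) :
    1 - ε ≤ μ.real {s | ∀ Y ∈ lowRankOnGraphs (firstCols P kr hkr) (firstCols Q kc hkc),
      (1 - δ) * ‖Y‖ ^ 2 ≤
          (n * p : ℝ) / (ρr * ρc) * ‖rowSampling (ωr s) * Y * colSampling (ωc s)‖ ^ 2 ∧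
        (n * p : ℝ) / (ρr * ρc) * ‖rowSampling (ωr s) * Y * colSampling (ωc s)‖ ^ 2 ≤
          (1 + δ) * ‖Y‖ ^ 2} :=
  theorem1_general (firstCols_transpose_mul_self hP.orthogonal hkr)
    (firstCols_transpose_mul_self hQ.orthogonal hkc) hωr hωc hδ hε hρc hρr
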